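/- For $h\in\mathbb{R}^d$ put $(\Delta_h g)(x)=g(x+h)-g(x)$, and let $\Delta_h^m$ be its $m$-th iterate. Let $C(\mathbb{R}^d)$ be the complex vector space of continuous functions $\mathbb{R}^d\to\mathbb{C}$. A continuous exponential polynomial on $\mathbb{R}^d$ is a finite sum $x\mapsto\sum_j p_j(x)\,e^{\langle\mu_j,x\rangle}$, where the $p_j$ are polynomials in $x_1,\dots,x_d$ with complex coefficients, $\mu_j\in\mathbb{C}^d$ and $\langle\mu,x\rangle=\sum_i\mu_i x_i$. **Theorem.** Let $d,t$ be positive integers, let $h_1,\dots,h_t\in\mathbb{R}^d$, and let $m_1,\dots,m_t\ge 1$ and $n_1,\dots,n_t\ge 0$ be integers. Let $H\subseteq C(\mathbb{R}^d)$ be a finite-dimensional linear subspace with $\Delta_{h_k}^{m_k}(H)\subseteq H$ for $k=1,\dots,t$, and let $f\in C(\mathbb{R}^d)$ satisfy $\Delta_{h_k}^{n_k}f\in H$ for $k=1,\dots,t$. Suppose that the closure of the additive subgroup $G$ of $\mathbb{R}^d$ generated by $h_1,\dots,h_t$ satisfies $\overline{G}=V\oplus\Lambda$ (that is, $\overline G=V+\Lambda$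 and $V\cap\Lambda=\{0\}$), where $V$ is a vector subspace of $\mathbb{R}^d$ and $\Lambda$ is a discrete additive subgroup of $\mathbb{R}^d$. Then for each $\lambda\in\Lambda$ there exists a continuous exponential polynomial $e_\lambda:\mathbb{R}^d\to\mathbb{C}$ such that $$f(x+\lambda)=e_\lambda(x)\quad\text{for all }x\in V.$$ If, moreover, $f$ is real-valued, then $e_\lambda$ can be chosen real-valued. -/

import Mathlib

/-- `e : ℝ^d → ℂ` is a continuous exponential polynomial: a finite sum of terms
`p(x) * exp (μ₁ x₁ + ⋯ + μ_d x_d)`, where `p` is a polynomial in the coordinates with complex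
coefficients and `μ ∈ ℂ^d`. -/
def IsExpPolynomial {d : ℕ} (e : EuclideanSpace ℝ (Fin d) → ℂ) : Prop :=
  ∃ (n : ℕ) (p : Fin n → MvPolynomial (Fin d) ℂ) (μ : Fin n → Fin d → ℂ),
    ∀ x : EuclideanSpace ℝ (Fin d),
      e x = ∑ j, MvPolynomial.eval (fun i => (x i : ℂ)) (p j) *
        Complex.exp (∑ i, μ j i * (x i : ℂ))

/-! The differences along the `h k` commute, so closing up `H` and `f` under finitely many of them
gives a finite-dimensional space `W` of continuous functions that contains `f` and is invariant
under translation by each `h k` (`exists_finiteDimensional_translationStabilizer`). The vectors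
whose translations preserve `W` form a closed subgroup, which therefore contains `V` and `Λ`. Hence
`f(· + λ)` lies in `W`, and `V` acts on `W` by a continuous matrix representation.

Along a basis of `V` this representation is a product of one-parameter groups. Each is
differentiable, and splitting into generalized eigenvectors of its generator shows that its entries
are exponential polynomials. Evaluating translates at 0 recovers the function on `V`
(`isExpPolynomial_of_le_translationStabilizer`). -/

/-! ### One-parameter groups of matrices. -/

theorem Polynomial.exists_derivative_eq {K : Type*} [Field K] [CharZero K] (p : Polynomial K) :
    ∃ q : Polynomial K, Polynomial.derivative q = p := by
  induction p using Polynomial.induction_on' with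
  | add p q hp hq =>
    obtain ⟨p', rfl⟩ := hp
    obtain ⟨q', rfl⟩ := hq
    exact ⟨p' + q', by simp⟩
  | monomial n a =>
    refine ⟨Polynomial.monomial (n + 1) (a / (n + 1)), ?_⟩
    rw [Polynomial.derivative_monomial]
    have : (n : K) + 1 ≠ 0 := by exact_mod_cast Nat.succ_ne_zero n
    simp [div_mul_cancel₀ _ this]

/-- A continuous one-parameter group in a Banach algebra is differentiable. -/
theorem exists_hasDerivAt_of_continuous_map_add {𝔸 : Type*} [NormedRing 𝔸] [NormedAlgebra ℝ 𝔸]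
    [CompleteSpace 𝔸] {T : ℝ → 𝔸} (hT : Continuous T) (h0 : T 0 = 1)
    (hadd : ∀ s t, T (s + t) = T s * T t) :
    ∃ a : 𝔸, ∀ t, HasDerivAt T (T t * a) t := by
  set G : ℝ → 𝔸 := fun u => ∫ s in (0 : ℝ)..u, T s with hG
  have hGd : ∀ u, HasDerivAt G (T u) u := fun u =>
    intervalIntegral.integral_hasDerivAt_right (hT.intervalIntegrable _ _)
      (hT.stronglyMeasurableAtFilter _ _) hT.continuousAt
  -- The means of `T` over short intervals tend to 1, so some mean is invertible. Dividing by it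
  -- expresses `T` through its primitive `G`, which is differentiable.
  have hslope : Filter.Tendsto (fun u => u⁻¹ • G u) (nhdsWithin 0 {0}ᶜ) (nhds 1) := by
    have h := hasDerivAt_iff_tendsto_slope_zero.1 (hGd 0)
    simpa [hG, h0] using h
  have hev : ∀ᶠ u in nhdsWithin (0 : ℝ) {0}ᶜ, IsUnit (u⁻¹ • G u) :=
    hslope.eventually (Units.isOpen.mem_nhds isUnit_one)
  obtain ⟨a, ⟨u, hu⟩, ha⟩ := (hev.and self_mem_nhdsWithin).exists
  have hTS : ∀ t, T t * (a⁻¹ • G a) = a⁻¹ • (G (t + a) - G t) := by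
    intro t
    have h1 : G (t + a) - G t = T t * G a := by
      simp only [hG]
      rw [intervalIntegral.integral_interval_sub_left (hT.intervalIntegrable _ _)
        (hT.intervalIntegrable _ _)]
      calc ∫ s in t..(t + a), T s = ∫ s in (0 : ℝ)..a, T (t + s) := by
            rw [intervalIntegral.integral_comp_add_left (fun s => T s) t, add_zero]
        _ = ∫ s in (0 : ℝ)..a, T t * T s := by simp only [hadd]
        _ = T t * ∫ s in (0 : ℝ)..a, T s :=
            (ContinuousLinearMap.mul ℝ 𝔸 (T t)).intervalIntegral_comp_comm (hT.intervalIntegrable _ _)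
    rw [h1, mul_smul_comm]
  have hTeq : T = fun t => (a⁻¹ • (G (t + a) - G t)) * ↑u⁻¹ := by
    funext t
    rw [← hTS, ← hu, mul_assoc, Units.mul_inv, mul_one]
  have hd : DifferentiableAt ℝ T 0 := by
    rw [hTeq]
    refine DifferentiableAt.mul_const (DifferentiableAt.fun_const_smul (DifferentiableAt.fun_sub ?_ ?_) _) _
    · exact ((hGd (0 + a)).comp_add_const 0 a).differentiableAt
    · exact (hGd 0).differentiableAt
  refine ⟨deriv T 0, fun t => ?_⟩
  have h1 : HasDerivAt (fun s => T t * T (s - t)) (T t * deriv T 0) t := by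
    refine HasDerivAt.const_mul _ ?_
    refine HasDerivAt.comp_sub_const t t ?_
    simpa using hd.hasDerivAt
  refine h1.congr_of_eventuallyEq (Filter.Eventually.of_forall fun s => ?_)
  simp [← hadd]

-- The norm serves only to make matrices a Banach algebra; the entrywise conclusion does not depend
-- on it.
attribute [local instance] Matrix.linftyOpNormedRing Matrix.linftyOpNormedAlgebra in
theorem Matrix.exists_hasDerivAt_of_continuous_map_add {ι : Type*} [Fintype ι] [DecidableEq ι]
    {T : ℝ → Matrix ι ι ℂ} (hT : Continuous T) (h0 : T 0 = 1)
    (hadd : ∀ s t, T (s + t) = T s * T t) :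
    ∃ a : Matrix ι ι ℂ, ∀ t i j, HasDerivAt (fun s => T s i j) ((T t * a) i j) t := by
  obtain ⟨a, ha⟩ := _root_.exists_hasDerivAt_of_continuous_map_add hT h0 hadd
  refine ⟨a, fun t i j => ?_⟩
  let L : Matrix ι ι ℂ →ₗ[ℝ] ℂ := Matrix.entryLinearMap ℝ ℂ i j
  exact (LinearMap.toContinuousLinearMap L).hasFDerivAt.comp_hasDerivAt t (ha t)

theorem exists_polynomial_of_hasDerivAt {v : ℝ → ℂ} {p : Polynomial ℂ}
    (h : ∀ t : ℝ, HasDerivAt v (p.eval (t : ℂ)) t) :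
    ∃ q : Polynomial ℂ, ∀ t : ℝ, v t = q.eval (t : ℂ) := by
  obtain ⟨q, rfl⟩ := p.exists_derivative_eq
  have hd : ∀ t : ℝ, HasDerivAt (fun t : ℝ => v t - q.eval (t : ℂ)) 0 t := fun t => by
    simpa using (h t).fun_sub ((q.hasDerivAt (t : ℂ)).comp_ofReal)
  have hc := is_const_of_deriv_eq_zero (fun t => (hd t).differentiableAt) fun t => (hd t).deriv
  refine ⟨q + Polynomial.C (v 0 - q.eval 0), fun t => ?_⟩
  have := hc t 0
  simp at this ⊢
  linear_combination this

open Matrix in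
/-- On a generalized eigenvector of its generator, a one-parameter group acts by an exponential
times a polynomial. -/
theorem Matrix.mulVec_eq_exp_mul_polynomial {ι : Type*} [Fintype ι] [DecidableEq ι]
    {T : ℝ → Matrix ι ι ℂ} {a : Matrix ι ι ℂ}
    (hT : ∀ t i j, HasDerivAt (fun s => T s i j) ((T t * a) i j) t) (μ : ℂ) (k : ℕ) :
    ∀ w : ι → ℂ, ((Matrix.toLin' a - algebraMap ℂ _ μ) ^ k) w = 0 →
      ∀ i, ∃ p : Polynomial ℂ, ∀ t : ℝ, (T t *ᵥ w) i = Complex.exp (μ * t) * p.eval (t : ℂ) := by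
  have hv : ∀ w i (t : ℝ), HasDerivAt (fun s => (T s *ᵥ w) i) ((T t *ᵥ (a *ᵥ w)) i) t := by
    intro w i t
    have : HasDerivAt (fun s => ∑ j, T s i j * w j) (∑ j, (T t * a) i j * w j) t :=
      HasDerivAt.fun_sum fun j _ => (hT t i j).mul_const _
    rw [Matrix.mulVec_mulVec]
    exact this
  induction k with
  | zero =>
    intro w hw i
    refine ⟨0, fun t => ?_⟩
    have : w = 0 := by simpa using hw
    simp [this]
  | succ k ih =>
    intro w hw i
    rw [pow_succ, Module.End.mul_apply] at hw
    obtain ⟨p, hp⟩ := ih _ hw i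
    -- The derivative is `exp (-μ t) T(t) (a - μ) w`, and `(a - μ) w` is killed by the `k`-th power,
    -- so the induction hypothesis makes it a polynomial.
    have hd : ∀ t : ℝ, HasDerivAt (fun s : ℝ => Complex.exp (-μ * s) * (T s *ᵥ w) i)
        (p.eval (t : ℂ)) t := by
      intro t
      have he : HasDerivAt (fun s : ℝ => Complex.exp (-μ * s)) (Complex.exp (-μ * t) * (-μ)) t := by
        have := ((hasDerivAt_id (t : ℂ)).const_mul (-μ)).cexp.comp_ofReal
        simpa using this
      refine (he.mul (hv w i t)).congr_deriv ?_
      have h1 := hp t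
      simp only [LinearMap.sub_apply, Matrix.toLin'_apply, Module.algebraMap_end_apply,
        Matrix.mulVec_sub, Matrix.mulVec_smul, Pi.sub_apply, Pi.smul_apply, smul_eq_mul] at h1
      have h2 : Complex.exp (-μ * t) * Complex.exp (μ * t) = 1 := by
        rw [← Complex.exp_add]; simp
      linear_combination Complex.exp (-μ * t) * h1 + p.eval (t : ℂ) * h2
    obtain ⟨q, hq⟩ := exists_polynomial_of_hasDerivAt hd
    refine ⟨q, fun t => ?_⟩
    rw [← hq t, ← mul_assoc, ← Complex.exp_add]
    simp

/-! ### Translations, differences and invariant finite-dimensional spaces. -/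

section Translation

variable {E : Type*} [AddCommGroup E]

/-- Translation by `v` as a linear operator on functions. -/
def shiftLin (v : E) : (E → ℂ) →ₗ[ℂ] (E → ℂ) := LinearMap.funLeft ℂ ℂ (fun x => x + v)

@[simp] theorem shiftLin_apply (v : E) (g : E → ℂ) (x : E) : shiftLin v g x = g (x + v) := rfl

theorem shiftLin_zero : shiftLin (0 : E) = LinearMap.id := by ext; simp

theorem shiftLin_add (v w : E) (g : E → ℂ) : shiftLin (v + w) g = shiftLin v (shiftLin w g) := by
  ext x; simp [add_assoc]

/-- The forward difference as a linear operator on functions. -/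
def fwdDiffLin (v : E) : Module.End ℂ (E → ℂ) := shiftLin v - 1

theorem fwdDiffLin_pow_apply (v : E) (k : ℕ) (g : E → ℂ) :
    (fwdDiffLin v ^ k) g = (fwdDiff v)^[k] g := by
  rw [Module.End.pow_apply]; rfl

theorem commute_fwdDiffLin (v w : E) : Commute (fwdDiffLin v) (fwdDiffLin w) := by
  have : Commute (shiftLin v : Module.End ℂ (E → ℂ)) (shiftLin w) := by
    ext g x
    simp [add_right_comm]
  exact (this.sub_left (Commute.one_left _)).sub_right (Commute.one_right _)

/-- For a finite-dimensional space of functions, the translations that preserve it form a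
subgroup. -/
def translationStabilizer (W : Submodule ℂ (E → ℂ)) [FiniteDimensional ℂ W] : AddSubgroup E where
  carrier := {v | ∀ g ∈ W, shiftLin v g ∈ W}
  zero_mem' g hg := by rwa [shiftLin_zero]
  add_mem' {v w} hv hw g hg := by rw [shiftLin_add]; exact hv _ (hw _ hg)
  neg_mem' {v} hv g hg := by
    -- An injective endomorphism of a finite-dimensional space is onto, so the inverse translation
    -- also preserves `W`.
    have hinj : Function.Injective ((shiftLin v).restrict hv) := by
      intro a b hab
      apply Subtype.ext
      have h1 : shiftLin v (a : E → ℂ) = shiftLin v b := congrArg Subtype.val hab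
      have h2 := congrArg (shiftLin (-v)) h1
      simpa [← shiftLin_add, shiftLin_zero] using h2
    obtain ⟨g', hg'⟩ := LinearMap.injective_iff_surjective.1 hinj ⟨g, hg⟩
    have h1 : shiftLin v (g' : E → ℂ) = g := congrArg Subtype.val hg'
    rw [← h1, ← shiftLin_add, neg_add_cancel, shiftLin_zero]
    exact g'.2

theorem continuous_shiftLin_apply [TopologicalSpace E] [ContinuousAdd E] {g : E → ℂ}
    (hg : Continuous g) : Continuous fun v => shiftLin v g :=
  continuous_pi fun _ => hg.comp (continuous_const.add continuous_id')

/-- In the topology of pointwise convergence `W` is closed, being finite-dimensional, and each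
continuous `g` has a continuous orbit map. -/
theorem isClosed_translationStabilizer [TopologicalSpace E] [ContinuousAdd E]
    (W : Submodule ℂ (E → ℂ)) [FiniteDimensional ℂ W] (hW : ∀ g ∈ W, Continuous g) :
    IsClosed (translationStabilizer W : Set E) := by
  have : (translationStabilizer W : Set E) =
      ⋂ g ∈ W, (fun v => shiftLin v g) ⁻¹' (W : Set (E → ℂ)) := by
    ext v; simp [translationStabilizer]
  rw [this]
  exact isClosed_biInter fun g hg =>
    W.closed_of_finiteDimensional.preimage (continuous_shiftLin_apply (hW g hg))

end Translation

/-- A finite-dimensional subspace preserved by powers of commuting operators `D k` lies in a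
finite-dimensional subspace preserved by the operators themselves. -/
theorem exists_finiteDimensional_invariant {K M ι : Type*} [Field K] [AddCommGroup M] [Module K M]
    (D : ι → Module.End K M) (hD : ∀ i j, Commute (D i) (D j)) (m : ι → ℕ) (hm : ∀ k, 1 ≤ m k)
    (C : Submodule K M) (hC : ∀ k, ∀ g ∈ C, D k g ∈ C)
    (H : Submodule K M) [FiniteDimensional K H] (hHC : H ≤ C)
    (hH : ∀ k, ∀ g ∈ H, (D k ^ m k) g ∈ H) (s : Finset ι) :
    ∃ W : Submodule K M, FiniteDimensional K W ∧ H ≤ W ∧ W ≤ C ∧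
      (∀ k ∈ s, ∀ g ∈ W, D k g ∈ W) ∧ ∀ k, ∀ g ∈ W, (D k ^ m k) g ∈ W := by
  classical
  induction s using Finset.induction_on with
  | empty => exact ⟨H, inferInstance, le_rfl, hHC, by simp, hH⟩
  | insert k s hk ih =>
    obtain ⟨W, hWfin, hHW, hWC, hWs, hWm⟩ := ih
    -- The enlarged space is the sum of the `D k ^ j` images of `W` for `j < m k`; the next power
    -- falls back into `W`.
    have hle : ∀ (j : ℕ), j < m k → W.map (D k ^ j) ≤ ⨆ j : Fin (m k), W.map (D k ^ (j : ℕ)) :=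
      fun j hj => le_iSup (fun j : Fin (m k) => W.map (D k ^ (j : ℕ))) ⟨j, hj⟩
    have hWle : W ≤ ⨆ j : Fin (m k), W.map (D k ^ (j : ℕ)) := by
      simpa [Module.End.one_eq_id] using hle 0 (hm k)
    have hinv : ∀ A : Module.End K M, Commute A (D k) → (∀ g ∈ W, A g ∈ W) →
        ∀ g ∈ ⨆ j : Fin (m k), W.map (D k ^ (j : ℕ)),
          A g ∈ ⨆ j : Fin (m k), W.map (D k ^ (j : ℕ)) := by
      intro A hA hAW
      refine fun g hg => (iSup_le fun j : Fin (m k) => ?_ :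
        _ ≤ (⨆ j : Fin (m k), W.map (D k ^ (j : ℕ))).comap A) hg
      rintro _ ⟨w, hw, rfl⟩
      refine hle j j.2 ⟨A w, hAW w hw, ?_⟩
      rw [← Module.End.mul_apply, ← (hA.pow_right _).eq, Module.End.mul_apply]
    refine ⟨⨆ j : Fin (m k), W.map (D k ^ (j : ℕ)), inferInstance, hHW.trans hWle,
      iSup_le fun j => ?_, ?_, fun i => hinv _ ((hD i k).pow_left _) (hWm i)⟩
    · rintro _ ⟨w, hw, rfl⟩
      generalize (j : ℕ) = a
      induction a with
      | zero => simpa using hWC hw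
      | succ a ih => rw [pow_succ', Module.End.mul_apply]; exact hC _ _ ih
    · intro i hi
      rcases Finset.mem_insert.1 hi with rfl | hi
      · refine fun g hg => (iSup_le fun j : Fin (m i) => ?_ :
          _ ≤ (⨆ j : Fin (m i), W.map (D i ^ (j : ℕ))).comap (D i)) hg
        rintro _ ⟨w, hw, rfl⟩
        rw [Submodule.mem_comap, ← Module.End.mul_apply, ← pow_succ']
        rcases Nat.lt_or_ge (j + 1) (m i) with h | h
        · exact hle _ h ⟨w, hw, rfl⟩
        · have : (j : ℕ) + 1 = m i := le_antisymm j.2 h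
          rw [this]
          exact hWle (hWm i w hw)
      · exact hinv _ (hD i k) (hWs i hi)

/-- A continuous function with iterated differences along each `h k` in a finite-dimensional space
of continuous functions preserved by powers of the `fwdDiff (h k)` lies in a finite-dimensional space invariant under translation by the `h k`. -/
theorem exists_finiteDimensional_translationStabilizer {E ι : Type*} [AddCommGroup E]
    [TopologicalSpace E] [ContinuousAdd E] [Fintype ι] (h : ι → E) (n m : ι → ℕ)
    (hm : ∀ k, 1 ≤ m k) (H : Submodule ℂ (E → ℂ)) (hHcont : ∀ g ∈ H, Continuous g)
    [FiniteDimensional ℂ H] (hHinv : ∀ k, ∀ g ∈ H, (fwdDiff (h k))^[m k] g ∈ H)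
    {f : E → ℂ} (hf : Continuous f) (hfH : ∀ k, (fwdDiff (h k))^[n k] f ∈ H) :
    ∃ (W : Submodule ℂ (E → ℂ)) (_ : FiniteDimensional ℂ W), f ∈ W ∧ (∀ g ∈ W, Continuous g) ∧
      ∀ k, h k ∈ translationStabilizer W := by
  let C : Submodule ℂ (E → ℂ) :=
    { carrier := {g | Continuous g}
      zero_mem' := continuous_zero
      add_mem' := fun ha hb => Continuous.add ha hb
      smul_mem' := fun c _ hg => Continuous.const_smul hg c }
  let D : ι → Module.End ℂ (E → ℂ) := fun k => fwdDiffLin (h k)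
  have hD : ∀ i j, Commute (D i) (D j) := fun i j => commute_fwdDiffLin _ _
  have hC : ∀ k, ∀ g ∈ C, D k g ∈ C := fun k g hg =>
    (hg.comp (continuous_id'.add continuous_const)).sub hg
  obtain ⟨W₁, hfin₁, hH₁, hC₁, hinv₁, -⟩ := exists_finiteDimensional_invariant D hD m hm C hC H
    hHcont (fun k g hg => by rw [fwdDiffLin_pow_apply]; exact hHinv k g hg) Finset.univ
  have hinv₁' : ∀ k j, ∀ g ∈ W₁, (D k ^ j) g ∈ W₁ := by
    intro k j g hg
    induction j with
    | zero => simpa using hg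
    | succ j ih => rw [pow_succ', Module.End.mul_apply]; exact hinv₁ k (Finset.mem_univ k) _ ih
  have hfC : Submodule.span ℂ {f} ≤ C := by
    rw [Submodule.span_singleton_le_iff_mem]; exact hf
  -- The exponent `n k + 1` is positive even when `n k = 0`, and still sends `f` into `W₁`.
  obtain ⟨W, hfin, hW, hWC, hinv, -⟩ := exists_finiteDimensional_invariant D hD (fun k => n k + 1)
    (fun k => Nat.le_add_left _ _) C hC (W₁ ⊔ Submodule.span ℂ {f}) (sup_le hC₁ hfC) (by
      intro k
      have : W₁ ⊔ Submodule.span ℂ {f} ≤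
          (W₁ ⊔ Submodule.span ℂ {f}).comap (D k ^ (n k + 1)) := by
        refine sup_le (fun g hg => Submodule.mem_sup_left (hinv₁' k _ g hg)) ?_
        rw [Submodule.span_singleton_le_iff_mem]
        refine Submodule.mem_sup_left ?_
        rw [pow_succ', Module.End.mul_apply, fwdDiffLin_pow_apply]
        exact hinv₁ k (Finset.mem_univ k) _ (hH₁ (hfH k))
      exact fun g hg => this hg) Finset.univ
  refine ⟨W, hfin, hW (Submodule.mem_sup_right (Submodule.mem_span_singleton_self f)), hWC,
    fun k g hg => ?_⟩
  have : shiftLin (h k) g = D k g + g := by simp [D, fwdDiffLin]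
  rw [this]
  exact W.add_mem (hinv k (Finset.mem_univ k) g hg) hg

/-! ### The algebra of exponential polynomials, and representations of real vector spaces. -/

section ExpPolynomial

variable {d : ℕ}

theorem isExpPolynomial_of_fintype {ι : Type*} [Fintype ι] {e : EuclideanSpace ℝ (Fin d) → ℂ}
    (p : ι → MvPolynomial (Fin d) ℂ) (μ : ι → Fin d → ℂ)
    (he : ∀ x, e x = ∑ j, MvPolynomial.eval (fun i => (x i : ℂ)) (p j) *
      Complex.exp (∑ i, μ j i * (x i : ℂ))) : IsExpPolynomial e := by
  let σ := Fintype.equivFin ι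
  refine ⟨Fintype.card ι, p ∘ σ.symm, μ ∘ σ.symm, fun x => ?_⟩
  rw [he x, ← σ.symm.sum_comp]
  rfl

theorem isExpPolynomial_const (c : ℂ) :
    IsExpPolynomial (fun _ : EuclideanSpace ℝ (Fin d) => c) :=
  isExpPolynomial_of_fintype (fun _ : Unit => MvPolynomial.C c) (fun _ _ => 0) (by simp)

theorem IsExpPolynomial.add {e₁ e₂ : EuclideanSpace ℝ (Fin d) → ℂ} (h₁ : IsExpPolynomial e₁)
    (h₂ : IsExpPolynomial e₂) : IsExpPolynomial fun x => e₁ x + e₂ x := by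
  obtain ⟨n₁, p₁, μ₁, h₁⟩ := h₁
  obtain ⟨n₂, p₂, μ₂, h₂⟩ := h₂
  exact isExpPolynomial_of_fintype (Sum.elim p₁ p₂) (Sum.elim μ₁ μ₂) fun x => by
    simp [h₁, h₂]

theorem IsExpPolynomial.mul {e₁ e₂ : EuclideanSpace ℝ (Fin d) → ℂ} (h₁ : IsExpPolynomial e₁)
    (h₂ : IsExpPolynomial e₂) : IsExpPolynomial fun x => e₁ x * e₂ x := by
  obtain ⟨n₁, p₁, μ₁, h₁⟩ := h₁
  obtain ⟨n₂, p₂, μ₂, h₂⟩ := h₂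
  refine isExpPolynomial_of_fintype (fun j : Fin n₁ × Fin n₂ => p₁ j.1 * p₂ j.2)
    (fun j i => μ₁ j.1 i + μ₂ j.2 i) fun x => ?_
  rw [h₁, h₂, Finset.sum_mul_sum, Fintype.sum_prod_type]
  refine Finset.sum_congr rfl fun a _ => Finset.sum_congr rfl fun b _ => ?_
  simp only [add_mul, Finset.sum_add_distrib, Complex.exp_add, map_mul]
  ring

theorem isExpPolynomial_sum {ι : Type*} (s : Finset ι) {e : ι → EuclideanSpace ℝ (Fin d) → ℂ}
    (h : ∀ j ∈ s, IsExpPolynomial (e j)) : IsExpPolynomial fun x => ∑ j ∈ s, e j x := by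
  classical
  induction s using Finset.induction_on with
  | empty => simpa using isExpPolynomial_const 0
  | insert j s hj ih =>
    simp only [Finset.sum_insert hj]
    exact (h j (Finset.mem_insert_self j s)).add
      (ih fun i hi => h i (Finset.mem_insert_of_mem hi))

theorem isExpPolynomial_exp_mul_polynomial (ℓ : EuclideanSpace ℝ (Fin d) →ₗ[ℝ] ℝ) (μ : ℂ)
    (p : Polynomial ℂ) :
    IsExpPolynomial fun x => Complex.exp (μ * (ℓ x : ℂ)) * p.eval (ℓ x : ℂ) := by
  set c : Fin d → ℝ := fun i => ℓ (EuclideanSpace.single i 1) with hc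
  have hℓ : ∀ x, (ℓ x : ℂ) = ∑ i, (c i : ℂ) * (x i : ℂ) := by
    intro x
    have h1 : x = ∑ i, x i • EuclideanSpace.single i (1 : ℝ) := by
      ext j; simp [Pi.single_apply]
    conv_lhs => rw [h1]
    simp [hc, mul_comm]
  let P : MvPolynomial (Fin d) ℂ :=
    Polynomial.aeval (∑ i, MvPolynomial.C (c i : ℂ) * MvPolynomial.X i) p
  refine isExpPolynomial_of_fintype (fun _ : Unit => P) (fun _ i => μ * c i) fun x => ?_
  have hP : MvPolynomial.eval (fun i => (x i : ℂ)) P = p.eval (ℓ x : ℂ) := by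
    rw [← MvPolynomial.coe_aeval_eq_eval, RingHom.coe_coe, ← Polynomial.aeval_algHom_apply, hℓ,
      Polynomial.coe_aeval_eq_eval]
    simp
  simp only [Finset.univ_unique, Finset.sum_singleton, hP, hℓ, Finset.mul_sum, mul_assoc]
  ring

open Matrix in
theorem isExpPolynomial_one_parameter {ι : Type*} [Fintype ι] [DecidableEq ι]
    {T : ℝ → Matrix ι ι ℂ} (hT : Continuous T) (h0 : T 0 = 1)
    (hadd : ∀ s t, T (s + t) = T s * T t) (ℓ : EuclideanSpace ℝ (Fin d) →ₗ[ℝ] ℝ) (i j : ι) :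
    IsExpPolynomial fun x => T (ℓ x) i j := by
  obtain ⟨a, ha⟩ := Matrix.exists_hasDerivAt_of_continuous_map_add hT h0 hadd
  have key : ∀ w : ι → ℂ, ∀ i, IsExpPolynomial fun x => (T (ℓ x) *ᵥ w) i := by
    intro w
    -- Over ℂ the generalized eigenspaces of the generator span, so it suffices to treat one
    -- generalized eigenvector.
    have hw : w ∈ ⨆ μ : ℂ, Module.End.maxGenEigenspace (Matrix.toLin' a) μ := by
      rw [Module.End.iSup_maxGenEigenspace_eq_top]; trivial
    induction hw using Submodule.iSup_induction' with
    | mem μ w hw =>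
      intro i
      obtain ⟨k, hk⟩ := Module.End.mem_maxGenEigenspace _ _ _ |>.1 hw
      obtain ⟨p, hp⟩ := Matrix.mulVec_eq_exp_mul_polynomial ha μ k w
        (by simpa [Algebra.algebraMap_eq_smul_one] using hk) i
      simp only [hp]
      exact isExpPolynomial_exp_mul_polynomial ℓ μ p
    | zero => intro i; simpa using isExpPolynomial_const 0
    | add w₁ w₂ _ _ h₁ h₂ =>
      intro i
      simp only [Matrix.mulVec_add, Pi.add_apply]
      exact (h₁ i).add (h₂ i)
  simpa using key (Pi.single j 1) i

/-- A continuous finite-dimensional matrix representation of a real vector space has exponential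
polynomials as entries. -/
theorem isExpPolynomial_representation {ι : Type*} [Fintype ι] [DecidableEq ι]
    {V : Type*} [AddCommGroup V] [Module ℝ V] [FiniteDimensional ℝ V] [TopologicalSpace V]
    [ContinuousSMul ℝ V] {T : V → Matrix ι ι ℂ} (hT : Continuous T) (h0 : T 0 = 1)
    (hadd : ∀ v w, T (v + w) = T v * T w) (π : EuclideanSpace ℝ (Fin d) →ₗ[ℝ] V) (i j : ι) :
    IsExpPolynomial fun x => T (π x) i j := by
  let b := Module.finBasis ℝ V
  have key : ∀ (s : Finset (Fin (Module.finrank ℝ V))) (i j : ι),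
      IsExpPolynomial fun x => T (∑ k ∈ s, b.coord k (π x) • b k) i j := by
    intro s
    induction s using Finset.induction_on with
    | empty => intro i j; simpa [h0] using isExpPolynomial_const _
    | insert k s hk ih =>
      intro i j
      simp only [Finset.sum_insert hk, hadd, Matrix.mul_apply]
      refine isExpPolynomial_sum _ fun l _ => IsExpPolynomial.mul ?_ (ih l j)
      exact isExpPolynomial_one_parameter (T := fun t => T (t • b k))
        (hT.comp (continuous_id.smul continuous_const)) (by simp [h0])
        (fun s t => by rw [add_smul, hadd]) (b.coord k ∘ₗ π) i l
  convert key Finset.univ i j using 4 with x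
  exact (b.sum_repr (π x)).symm

end ExpPolynomial

/-- Anselone–Korevaar: a function in a finite-dimensional space of continuous functions that is
invariant under translation by a real subspace `V` is an exponential polynomial along `V`. -/
theorem isExpPolynomial_of_le_translationStabilizer {d : ℕ}
    (W : Submodule ℂ (EuclideanSpace ℝ (Fin d) → ℂ)) [FiniteDimensional ℂ W]
    (hW : ∀ g ∈ W, Continuous g) (V : Submodule ℝ (EuclideanSpace ℝ (Fin d)))
    (hV : ∀ v ∈ V, v ∈ translationStabilizer W) (π : EuclideanSpace ℝ (Fin d) →ₗ[ℝ] V)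
    {F : EuclideanSpace ℝ (Fin d) → ℂ} (hF : F ∈ W) : IsExpPolynomial fun x => F (π x) := by
  let S : V → Module.End ℂ W := fun v => (shiftLin (v : EuclideanSpace ℝ (Fin d))).restrict (hV v v.2)
  have hS : ∀ v (g : W), ((S v g : W) : EuclideanSpace ℝ (Fin d) → ℂ) =
      shiftLin (v : EuclideanSpace ℝ (Fin d)) (g : EuclideanSpace ℝ (Fin d) → ℂ) := fun _ _ => rfl
  let b := Module.finBasis ℂ W
  let T : V → Matrix _ _ ℂ := fun v => LinearMap.toMatrix b b (S v)
  have hT : Continuous T := by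
    refine continuous_matrix fun i j => ?_
    have h1 : Continuous fun v : V => S v (b j) :=
      ((continuous_shiftLin_apply (hW _ (b j).2)).comp continuous_subtype_val).subtype_mk _
    simpa [T, LinearMap.toMatrix_apply] using!
      (LinearMap.continuous_of_finiteDimensional (b.coord i)).comp h1
  have h0 : T 0 = 1 := by
    have : S 0 = LinearMap.id := by
      ext g : 2
      rw [hS]; simp [shiftLin_zero]
    simp [T, this]
  have hadd : ∀ v w, T (v + w) = T v * T w := by
    intro v w
    have : S (v + w) = S v ∘ₗ S w := by
      ext g : 2
      rw [hS, LinearMap.comp_apply, hS, hS, ← shiftLin_add]; rfl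
    simp only [T, this, LinearMap.toMatrix_comp b b b]
  -- `F v` is the value at 0 of the translate of `F` by `v`, expanded in the basis `b`.
  have hFx : ∀ v : V, F v = ∑ i, ∑ j, T v i j * (b.repr ⟨F, hF⟩ j *
      (b i : EuclideanSpace ℝ (Fin d) → ℂ) 0) := by
    intro v
    have h1 : S v ⟨F, hF⟩ = ∑ i, (∑ j, T v i j * b.repr ⟨F, hF⟩ j) • b i := by
      conv_lhs => rw [← b.sum_repr (S v ⟨F, hF⟩)]
      refine Finset.sum_congr rfl fun i _ => ?_
      have := congrFun (LinearMap.toMatrix_mulVec_repr b b (S v) ⟨F, hF⟩) i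
      rw [← this]; rfl
    have h2 : F v = (S v ⟨F, hF⟩ : EuclideanSpace ℝ (Fin d) → ℂ) 0 := by
      rw [hS]; simp
    rw [h2, h1]
    simp [Finset.sum_apply, Finset.sum_mul, mul_assoc]
  simp only [hFx]
  exact isExpPolynomial_sum _ fun i _ => isExpPolynomial_sum _ fun j _ =>
    (isExpPolynomial_representation hT h0 hadd π i j).mul (isExpPolynomial_const _)

theorem mainTheorem3 {d t : ℕ} (h : Fin t → EuclideanSpace ℝ (Fin d))
    (n m : Fin t → ℕ) (hm : ∀ k, 1 ≤ m k)
    (H : Submodule ℂ (EuclideanSpace ℝ (Fin d) → ℂ))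
    (hHcont : ∀ g ∈ H, Continuous g)
    (hHfin : FiniteDimensional ℂ H)
    (hHinv : ∀ k, ∀ g ∈ H, (fwdDiff (h k))^[m k] g ∈ H)
    (f : EuclideanSpace ℝ (Fin d) → ℂ) (hf : Continuous f)
    (hfH : ∀ k, (fwdDiff (h k))^[n k] f ∈ H)
    (V : Submodule ℝ (EuclideanSpace ℝ (Fin d)))
    (Λ : AddSubgroup (EuclideanSpace ℝ (Fin d))) (hΛ : DiscreteTopology Λ)
    (hsum : (AddSubgroup.closure (Set.range h)).topologicalClosure = V.toAddSubgroup ⊔ Λ)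
    (hdirect : Disjoint V.toAddSubgroup Λ) :
    ∀ l ∈ Λ, ∃ e : EuclideanSpace ℝ (Fin d) → ℂ,
      IsExpPolynomial e ∧ (∀ x ∈ V, f (x + l) = e x) ∧
        ((∀ x, (f x).im = 0) → ∀ x, (e x).im = 0) := by
  obtain ⟨W, hWfin, hfW, hWcont, hW⟩ :=
    exists_finiteDimensional_translationStabilizer h n m hm H hHcont hHinv hf hfH
  have hcl : V.toAddSubgroup ⊔ Λ ≤ translationStabilizer W := by
    rw [← hsum]
    refine AddSubgroup.topologicalClosure_minimal _ ?_ (isClosed_translationStabilizer W hWcont)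
    rw [AddSubgroup.closure_le]
    rintro _ ⟨k, rfl⟩
    exact hW k
  intro l hl
  obtain ⟨π, hπ⟩ := V.subtype.exists_leftInverse_of_injective V.ker_subtype
  -- With `π` a linear projection onto `V`, this witness takes only values of `f`, so it is real
  -- whenever `f` is.
  refine ⟨fun x => f (π x + l), ?_, fun x hx => ?_, fun hre x => hre _⟩
  · exact isExpPolynomial_of_le_translationStabilizer W hWcont V
      (fun v hv => hcl (AddSubgroup.mem_sup_left hv)) π
      (hcl (AddSubgroup.mem_sup_right hl) f hfW)
  · have : π x = ⟨x, hx⟩ := LinearMap.congr_fun hπ ⟨x, hx⟩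
    simp only [this]
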